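/- **Theorem 1.** Let $\mathcal M=(\mathcal S,Act,T,\kappa_0)$ be a finite Markov decision process with transition function $T(s'\mid s,\alpha)$ and initial distribution $\kappa_0$, let $\gamma\in(0,1)$ and $p\in[1,\infty)$, let $c,d^1,\dots,d^{n_c}:\mathcal S\times Act\to[0,\infty)$ be stage costs and let $\beta^1,\dots,\beta^{n_c}>0$. A policy $\pi=(\pi_t)_{t\ge0}$ (possibly history-dependent and randomized) induces the law $\mathbb P^\pi$ of the process $(s_t,\alpha_t)_{t\ge0}$, where $s_0\sim\kappa_0$, $\alpha_t\sim\pi_t(\cdot\mid s_0,\alpha_0,\dots,s_{t-1},\alpha_{t-1},s_t)$ and $s_{t+1}\sim T(\cdot\mid s_t,\alpha_t)$. Let $\mathcal F_t$ be the $\sigma$-algebra generated by $(s_0,\alpha_0),\dots,(s_t,\alpha_t)$ and $\mathcal C_t=\mathcal L_p(\mathcal F_t,\mathbb P^\pi)$. Fix a class $\Pi$ of admissible policies (for instance, all policies). For every $\pi\in\Pi$ and $t\ge 0$ let $\rho_t=\rho^\pi_t:\mathcal C_{t+1}\to\mathcal C_t$ be a coherent one-step conditional risk measure, that is, $\mathbb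 P^\pi$-almost surely, (convexity) $\rho_t(lZ+(1-l)Z')\le l\rho_t(Z)+(1-l)\rho_t(Z')$ for $l\in(0,1)$; (monotonicity) $Z\le Z'$ implies $\rho_t(Z)\le\rho_t(Z')$; (translation invariance) $\rho_t(Y+Z)=Y+\rho_t(Z)$ for $Y\in\mathcal C_t$; (positive homogeneity) $\rho_t(bZ)=b\rho_t(Z)$ for $b\ge0$; here $Z,Z'\in\mathcal C_{t+1}$. Assume that these are Markov risk measures with one common risk transition mapping $\sigma$: for all $\pi\in\Pi$, $t\ge0$ and $v:\mathcal S\to\mathbb R$, $\mathbb P^\pi$-almost surely, $$\rho_t\big(v(s_{t+1})\big)=\sigma\big(v,s_t,T(\cdot\mid s_t,\alpha_t)\big).$$ For a stage cost $f$ let $$\rho^\gamma(f)=\lim_{t\to\infty}\rho_0\Big(f_0+\rho_1\big(\gamma f_1+\cdots+\rho_{t-1}(\gamma^{t-1}f_{t-1}+\rho_t(\gamma^t f_t))\cdots\big)\Big),\qquad f_t=f(s_t,\alpha_t),$$ and let $J_\gamma(\kappa_0,\pi)=\mathbb E^\pi[\rho^\gamma(c)]$ and $D^i_\gamma(\kappa_0,\pi)=\mathbb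 E^\pi[\rho^\gamma(d^i)]$ (the $\mathcal F_0$-measurable total risk is averaged over the initial stage, $s_0\sim\kappa_0$). Let $$J_\gamma(\kappa_0)=\inf\{J_\gamma(\kappa_0,\pi):\pi\in\Pi,\ D^i_\gamma(\kappa_0,\pi)\le\beta^i,\ i=1,\dots,n_c\}\in(-\infty,+\infty],$$ which is $+\infty$ if no policy in $\Pi$ satisfies the constraints. Then every solution (maximizer) $(V^*,\lambda^*)$ of $$\sup_{V\in\mathbb R^{\mathcal S},\ \lambda\in\mathbb R^{n_c},\ \lambda\succeq0}\ \langle\kappa_0,V\rangle-\langle\lambda,\beta\rangle\quad\text{subject to}\quad V(s)\le c(s,\alpha)+\langle\lambda,d(s,\alpha)\rangle+\gamma\,\sigma\big(V,s,T(\cdot\mid s,\alpha)\big)\ \ \forall s\in\mathcal S,\ \alpha\in Act,$$ satisfies $$J_\gamma(\kappa_0)\ \ge\ \langle\kappa_0,V^*\rangle-\langle\lambda^*,\beta\rangle .$$ -/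

import Mathlib

open MeasureTheory ProbabilityTheory Filter

noncomputable section

namespace RiskMDP

/-! ### Coherent one-step risk measures on a filtered probability space -/

section Risk

variable {Ω : Type*} {m : MeasurableSpace Ω}

/-- The space `C_t = L_p(Ω, ℱ_t, P)`, represented by functions: the `ℱ_t`-measurable real random
variables with finite `p`-th moment. Equality of its elements is equality almost everywhere. -/
def CostSpace (ℱ : Filtration ℕ m) (P : Measure Ω) (p : ENNReal) (t : ℕ) : Set (Ω → ℝ) :=
  {Z | Measurable[ℱ t] Z ∧ MemLp Z p P}

/-- `ρ` is a coherent one-step conditional risk measure `C_{t+1} → C_t`. All relations hold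
`P`-almost surely; monotonicity makes `ρ` well defined on classes modulo almost sure equality. -/
structure IsCoherent (ℱ : Filtration ℕ m) (P : Measure Ω) (p : ENNReal) (t : ℕ)
    (ρ : (Ω → ℝ) → (Ω → ℝ)) : Prop where
  mapsTo : ∀ Z ∈ CostSpace ℱ P p (t + 1), ρ Z ∈ CostSpace ℱ P p t
  convex : ∀ Z ∈ CostSpace ℱ P p (t + 1), ∀ Z' ∈ CostSpace ℱ P p (t + 1),
    ∀ l : ℝ, 0 < l → l < 1 →
      ρ (l • Z + (1 - l) • Z') ≤ᵐ[P] l • ρ Z + (1 - l) • ρ Z'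
  monotone : ∀ Z ∈ CostSpace ℱ P p (t + 1), ∀ Z' ∈ CostSpace ℱ P p (t + 1),
    Z ≤ᵐ[P] Z' → ρ Z ≤ᵐ[P] ρ Z'
  translation : ∀ Y ∈ CostSpace ℱ P p t, ∀ Z ∈ CostSpace ℱ P p (t + 1),
    ρ (Y + Z) =ᵐ[P] Y + ρ Z
  pos_homogeneous : ∀ Z ∈ CostSpace ℱ P p (t + 1), ∀ b : ℝ, 0 ≤ b →
    ρ (b • Z) =ᵐ[P] b • ρ Z

/-- The nested discounted risk of `n + 1` stages starting at stage `t`: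
`ρ_t(γ^t c_t + ρ_{t+1}(γ^{t+1} c_{t+1} + ⋯ + ρ_{t+n}(γ^{t+n} c_{t+n})))`. -/
def nestedRisk (ρ : ℕ → (Ω → ℝ) → (Ω → ℝ)) (γ : ℝ) (c : ℕ → Ω → ℝ) : ℕ → ℕ → Ω → ℝ
  | 0, t => ρ t (γ ^ t • c t)
  | n + 1, t => ρ t (γ ^ t • c t + nestedRisk ρ γ c n (t + 1))

/-- The total discounted risk `ρ^γ(c) = lim_{t → ∞} ρ^γ_{0,t}(c_0, …, c_t)`. -/
def totalRisk (ρ : ℕ → (Ω → ℝ) → (Ω → ℝ)) (γ : ℝ) (c : ℕ → Ω → ℝ) : Ω → ℝ :=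
  fun ω => limUnder atTop (fun t : ℕ => nestedRisk ρ γ c t 0 ω)

end Risk

end RiskMDP

/-! ### Finite Markov decision processes -/

/-- A Markov decision process with state set `S` and action set `A`: the transition function
`T(· | s, α)` and the initial distribution `κ₀`. -/
structure RiskMDP.MDP (S A : Type*) where
  T : S → A → PMF S
  κ₀ : PMF S

namespace RiskMDP

section ControlledChain

variable {S A : Type*}

/-- A policy, possibly history dependent and randomized: `π t h s` is the distribution of the
action at time `t`, given the earlier state-action pairs `h` and the current state `s`. -/
abbrev Policy (S A : Type*) := (t : ℕ) → (Fin t → S × A) → S → PMF A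

/-- State-action trajectories `(s_0, α_0), (s_1, α_1), …`. -/
abbrev Trajectory (S A : Type*) := ℕ → S × A

/-- The state `s_t`. -/
def state (t : ℕ) (ω : Trajectory S A) : S := (ω t).1

/-- The action `α_t`. -/
def action (t : ℕ) (ω : Trajectory S A) : A := (ω t).2

/-- The law of `(s_0, α_0)`. -/
def initialLaw (M : MDP S A) (π : Policy S A) : PMF (S × A) :=
  M.κ₀.bind fun s => (π 0 Fin.elim0 s).map (Prod.mk s)

/-- The law of `(s_{t+1}, α_{t+1})` given the history `(s_0, α_0), …, (s_t, α_t)`. -/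
def stepLaw (M : MDP S A) (π : Policy S A) (t : ℕ) (h : Fin (t + 1) → S × A) : PMF (S × A) :=
  (M.T (h (Fin.last t)).1 (h (Fin.last t)).2).bind fun s => (π (t + 1) h s).map (Prod.mk s)

variable [MeasurableSpace S] [MeasurableSpace A]
  [Finite S] [Finite A] [DiscreteMeasurableSpace S] [DiscreteMeasurableSpace A]

/-- The law of `(s_{t+1}, α_{t+1})` given the history, as a Markov kernel. -/
def stepKernel (M : MDP S A) (π : Policy S A) (t : ℕ) :
    Kernel ((i : Finset.Iic t) → S × A) (S × A) where
  toFun h := (stepLaw M π t fun i =>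
    h ⟨i, Finset.mem_Iic.2 (Nat.lt_succ_iff.1 i.isLt)⟩).toMeasure
  measurable' := Measurable.of_discrete

instance (M : MDP S A) (π : Policy S A) (t : ℕ) : IsMarkovKernel (stepKernel M π t) :=
  ⟨fun h => PMF.toMeasure.isProbabilityMeasure
    (stepLaw M π t fun i => h ⟨i, Finset.mem_Iic.2 (Nat.lt_succ_iff.1 i.isLt)⟩)⟩

/-- The law of the controlled process under the policy `π`, started from `s_0 ∼ κ₀`. -/
def pathMeasure (M : MDP S A) (π : Policy S A) : Measure (Trajectory S A) :=
  Kernel.trajMeasure (X := fun _ => S × A) (initialLaw M π).toMeasure (stepKernel M π)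

instance (M : MDP S A) (π : Policy S A) : IsProbabilityMeasure (pathMeasure M π) := by
  have : IsProbabilityMeasure (initialLaw M π).toMeasure :=
    PMF.toMeasure.isProbabilityMeasure (initialLaw M π)
  unfold pathMeasure
  infer_instance

/-- The filtration `ℱ_t` generated by `(s_0, α_0), …, (s_t, α_t)`. -/
def history : Filtration ℕ (inferInstance : MeasurableSpace (Trajectory S A)) :=
  Filtration.piLE (X := fun _ => S × A)

/-- A risk transition mapping `σ(v, s, q)`, with `v` a function of the next state, `s` the current
state and `q` a probability distribution of the next state. -/
abbrev RiskTransitionMapping (S : Type*) := (S → ℝ) → S → PMF S → ℝ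

/-- `ρ` is, at stage `t` and under the policy `π`, a Markov risk measure with risk transition
mapping `σ`: almost surely `ρ(v(s_{t+1})) = σ(v, s_t, T(· | s_t, α_t))`. -/
def IsMarkovRisk (M : MDP S A) (π : Policy S A) (σ : RiskTransitionMapping S) (t : ℕ)
    (ρ : (Trajectory S A → ℝ) → (Trajectory S A → ℝ)) : Prop :=
  ∀ v : S → ℝ, ρ (fun ω => v (state (t + 1) ω)) =ᵐ[pathMeasure M π]
    fun ω => σ v (state t ω) (M.T (state t ω) (action t ω))

/-- The `γ`-discounted dynamic risk of the stage cost `c` under the policy `π`, when the one-step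
risk measures are `ρ_0, ρ_1, …`; the initial state is averaged with respect to its law `κ₀`. -/
def dynamicRisk (M : MDP S A) (π : Policy S A)
    (ρ : ℕ → (Trajectory S A → ℝ) → (Trajectory S A → ℝ)) (γ : ℝ) (c : S → A → ℝ) : ℝ :=
  ∫ ω, totalRisk ρ γ (fun t ω => c (state t ω) (action t ω)) ω ∂(pathMeasure M π)

/-- The value of the constrained risk-averse problem over the class `adm` of policies: the infimum
of the risk of `c` subject to the risk of each `d i` being at most `β i`. It is `+∞` if no policy
of the class satisfies the constraints. -/
def constrainedValue (M : MDP S A) (adm : Set (Policy S A))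
    (ρ : Policy S A → ℕ → (Trajectory S A → ℝ) → (Trajectory S A → ℝ)) (γ : ℝ)
    (c : S → A → ℝ) {n : ℕ} (d : Fin n → S → A → ℝ) (β : Fin n → ℝ) : EReal :=
  ⨅ π ∈ {π ∈ adm | ∀ i, dynamicRisk M π (ρ π) γ (d i) ≤ β i},
    ((dynamicRisk M π (ρ π) γ c : ℝ) : EReal)

end ControlledChain

section Optimization

variable {S A : Type*} {n : ℕ}

/-- The feasible pairs `(V, lam)`: `lam ≥ 0` and
`V(s) ≤ c(s, α) + ⟨lam, d(s, α)⟩ + γ σ(V, s, T(· | s, α))` for all `s` and `α`. -/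
def bellmanFeasible (M : MDP S A) (σ : RiskTransitionMapping S) (γ : ℝ) (c : S → A → ℝ)
    (d : Fin n → S → A → ℝ) : Set ((S → ℝ) × (Fin n → ℝ)) :=
  {x | (∀ i, 0 ≤ x.2 i) ∧
    ∀ s a, x.1 s ≤ c s a + ∑ i, x.2 i * d i s a + γ * σ x.1 s (M.T s a)}

/-- The objective `⟨κ₀, V⟩ - ⟨lam, β⟩`. -/
def bellmanObjective [Fintype S] (M : MDP S A) (β : Fin n → ℝ) (x : (S → ℝ) × (Fin n → ℝ)) : ℝ :=
  ∑ s, (M.κ₀ s).toReal * x.1 s - ∑ i, x.2 i * β i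

end Optimization

end RiskMDP

end

/-! This is weak Lagrangian duality. Fix an admissible policy satisfying the constraints and a
feasible pair `(V, lam)`. Since the risk measures are Markov, feasibility says that `W_t = V(s_t)`
satisfies `W_t ≤ L_t + γ ρ_t(W_{t+1})` for the Lagrangian cost `L = c + ∑ lam i • d i`. Iterating
through monotonicity bounds `V(s_0)` by the nested risk of `L` plus an error of order `γ ^ (k + 1)`
(`sub_le_nestedRisk`).

Coherence makes each `ρ_t` sublinear, so for `lam ≥ 0` the nested risk of `L` is at most that of `c`
plus the `lam`-weighted risks of the `d i` (`nestedRisk_add_sum_smul_le`). Letting the horizon grow,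
integrating, and using `D^i ≤ β i` gives the bound. -/

namespace RiskMDP

/-! ### Coherent one-step risk measures -/

section Coherent

variable {Ω : Type*} {m : MeasurableSpace Ω} {ℱ : Filtration ℕ m} {P : Measure Ω} {p : ENNReal}
  {t : ℕ}

namespace CostSpace

lemma add {Y Z : Ω → ℝ} (hY : Y ∈ CostSpace ℱ P p t) (hZ : Z ∈ CostSpace ℱ P p t) :
    Y + Z ∈ CostSpace ℱ P p t :=
  ⟨hY.1.add hZ.1, hY.2.add hZ.2⟩

lemma smul {Z : Ω → ℝ} (hZ : Z ∈ CostSpace ℱ P p t) (b : ℝ) : b • Z ∈ CostSpace ℱ P p t :=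
  ⟨hZ.1.const_smul b, hZ.2.const_smul b⟩

lemma succ {Z : Ω → ℝ} (hZ : Z ∈ CostSpace ℱ P p t) : Z ∈ CostSpace ℱ P p (t + 1) :=
  ⟨hZ.1.mono (ℱ.mono t.le_succ) le_rfl, hZ.2⟩

lemma const [IsFiniteMeasure P] (b : ℝ) : (fun _ : Ω => b) ∈ CostSpace ℱ P p t :=
  ⟨measurable_const, memLp_const b⟩

lemma zero : (0 : Ω → ℝ) ∈ CostSpace ℱ P p t :=
  ⟨measurable_const, MemLp.zero⟩

end CostSpace

namespace IsCoherent

variable {ρ : (Ω → ℝ) → (Ω → ℝ)}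

lemma map_zero (h : IsCoherent ℱ P p t ρ) : ρ 0 =ᵐ[P] 0 := by
  simpa using h.pos_homogeneous 0 CostSpace.zero 0 le_rfl

lemma map_of_mem (h : IsCoherent ℱ P p t ρ) {Y : Ω → ℝ} (hY : Y ∈ CostSpace ℱ P p t) :
    ρ Y =ᵐ[P] Y := by
  have h1 := h.translation Y hY 0 CostSpace.zero
  rw [add_zero] at h1
  filter_upwards [h1, h.map_zero] with ω h1 h2
  simp [h1, h2]

/-- Convexity at the midpoint of `2Z` and `2Z'`; homogeneity cancels the factors 2. -/
lemma map_add_le (h : IsCoherent ℱ P p t ρ) {Z Z' : Ω → ℝ} (hZ : Z ∈ CostSpace ℱ P p (t + 1))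
    (hZ' : Z' ∈ CostSpace ℱ P p (t + 1)) : ρ (Z + Z') ≤ᵐ[P] ρ Z + ρ Z' := by
  have h1 := h.convex _ (CostSpace.smul hZ 2) _ (CostSpace.smul hZ' 2) (1 / 2) (by norm_num)
      (by norm_num)
  have e : (1 / 2 : ℝ) • (2 : ℝ) • Z + (1 - 1 / 2 : ℝ) • (2 : ℝ) • Z' = Z + Z' := by
    ext ω
    simp only [Pi.add_apply, Pi.smul_apply, smul_eq_mul]
    ring
  rw [e] at h1
  filter_upwards [h1, h.pos_homogeneous Z hZ 2 (by norm_num),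
    h.pos_homogeneous Z' hZ' 2 (by norm_num)] with ω h1 h2 h3
  simp only [Pi.add_apply, Pi.smul_apply, smul_eq_mul] at h1 h2 h3 ⊢
  rw [h2, h3] at h1
  linarith

lemma le_const [IsFiniteMeasure P] (h : IsCoherent ℱ P p t ρ) {Z : Ω → ℝ}
    (hZ : Z ∈ CostSpace ℱ P p (t + 1)) {b : ℝ} (hb : ∀ᵐ ω ∂P, Z ω ≤ b) :
    ∀ᵐ ω ∂P, ρ Z ω ≤ b := by
  filter_upwards [h.monotone Z hZ _ (CostSpace.const b) hb,
    h.map_of_mem (CostSpace.const b)] with ω h1 h2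
  exact h1.trans_eq h2

lemma nonneg (h : IsCoherent ℱ P p t ρ) {Z : Ω → ℝ} (hZ : Z ∈ CostSpace ℱ P p (t + 1))
    (h0 : ∀ᵐ ω ∂P, 0 ≤ Z ω) : ∀ᵐ ω ∂P, 0 ≤ ρ Z ω := by
  filter_upwards [h.monotone 0 CostSpace.zero Z hZ h0, h.map_zero] with ω h1 h2
  exact h2.symm.trans_le h1

end IsCoherent

end Coherent

/-! ### Nested and total discounted risk -/

section Nested

variable {Ω : Type*} {m : MeasurableSpace Ω} {ℱ : Filtration ℕ m} {P : Measure Ω} {p : ENNReal}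
  {ρ : ℕ → (Ω → ℝ) → (Ω → ℝ)} {γ : ℝ} {c : ℕ → Ω → ℝ}

lemma nestedRisk_mem (h : ∀ t, IsCoherent ℱ P p t (ρ t)) (hc : ∀ t, c t ∈ CostSpace ℱ P p t)
    (n t : ℕ) : nestedRisk ρ γ c n t ∈ CostSpace ℱ P p t := by
  induction n generalizing t with
  | zero => exact (h t).mapsTo _ (CostSpace.succ (CostSpace.smul (hc t) _))
  | succ n ih =>
    exact (h t).mapsTo _ (CostSpace.add (CostSpace.succ (CostSpace.smul (hc t) _)) (ih (t + 1)))

lemma nestedRisk_succ (h : ∀ t, IsCoherent ℱ P p t (ρ t)) (hc : ∀ t, c t ∈ CostSpace ℱ P p t)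
    (n t : ℕ) :
    nestedRisk ρ γ c (n + 1) t =ᵐ[P] γ ^ t • c t + ρ t (nestedRisk ρ γ c n (t + 1)) :=
  (h t).translation _ (CostSpace.smul (hc t) _) _ (nestedRisk_mem h hc n (t + 1))

lemma nestedRisk_zero (h : ∀ t, IsCoherent ℱ P p t (ρ t)) (hc : ∀ t, c t ∈ CostSpace ℱ P p t)
    (t : ℕ) : nestedRisk ρ γ c 0 t =ᵐ[P] γ ^ t • c t :=
  (h t).map_of_mem (CostSpace.smul (hc t) _)

lemma nestedRisk_nonneg (h : ∀ t, IsCoherent ℱ P p t (ρ t))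
    (hc : ∀ t, c t ∈ CostSpace ℱ P p t) (hγ : 0 ≤ γ) (hc0 : ∀ t ω, 0 ≤ c t ω) (n t : ℕ) :
    ∀ᵐ ω ∂P, 0 ≤ nestedRisk ρ γ c n t ω := by
  have h1 (ω : Ω) (t : ℕ) : 0 ≤ (γ ^ t • c t) ω := mul_nonneg (pow_nonneg hγ t) (hc0 t ω)
  induction n generalizing t with
  | zero =>
    exact (h t).nonneg (CostSpace.succ (CostSpace.smul (hc t) _)) (.of_forall fun ω => h1 ω t)
  | succ n ih =>
    refine (h t).nonneg (CostSpace.add (CostSpace.succ (CostSpace.smul (hc t) _))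
        (nestedRisk_mem h hc n (t + 1))) ?_
    filter_upwards [ih (t + 1)] with ω h2
    exact add_nonneg (h1 ω t) h2

/-- One more stage adds a nonnegative risk to the innermost argument, and monotonicity carries the
inequality outwards. -/
lemma nestedRisk_le_succ (h : ∀ t, IsCoherent ℱ P p t (ρ t))
    (hc : ∀ t, c t ∈ CostSpace ℱ P p t) (hγ : 0 ≤ γ) (hc0 : ∀ t ω, 0 ≤ c t ω) (n t : ℕ) :
    nestedRisk ρ γ c n t ≤ᵐ[P] nestedRisk ρ γ c (n + 1) t := by
  induction n generalizing t with
  | zero =>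
    refine (h t).monotone _ (CostSpace.succ (CostSpace.smul (hc t) _)) _
      (CostSpace.add (CostSpace.succ (CostSpace.smul (hc t) _)) (nestedRisk_mem h hc 0 (t + 1))) ?_
    filter_upwards [nestedRisk_nonneg h hc hγ hc0 0 (t + 1)] with ω h2
    exact le_add_of_nonneg_right h2
  | succ n ih =>
    refine (h t).monotone _ (CostSpace.add (CostSpace.succ (CostSpace.smul (hc t) _))
        (nestedRisk_mem h hc n (t + 1))) _
      (CostSpace.add (CostSpace.succ (CostSpace.smul (hc t) _))
        (nestedRisk_mem h hc (n + 1) (t + 1))) ?_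
    filter_upwards [ih (t + 1)] with ω h2
    exact add_le_add_right h2 _

lemma nestedRisk_le [IsFiniteMeasure P] (h : ∀ t, IsCoherent ℱ P p t (ρ t))
    (hc : ∀ t, c t ∈ CostSpace ℱ P p t) (hγ : 0 ≤ γ) (hγ₁ : γ < 1) {K : ℝ} (hK : 0 ≤ K)
    (hcK : ∀ t ω, c t ω ≤ K) (n t : ℕ) :
    ∀ᵐ ω ∂P, nestedRisk ρ γ c n t ω ≤ γ ^ t * (K / (1 - γ)) := by
  have hγ' : 0 < 1 - γ := sub_pos.2 hγ₁
  have h1 (ω : Ω) (t : ℕ) : (γ ^ t • c t) ω ≤ γ ^ t * K :=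
    mul_le_mul_of_nonneg_left (hcK t ω) (pow_nonneg hγ t)
  -- `K / (1 - γ)` is the fixed point of `x = K + γ x`, so the bound reproduces itself from stage to
  -- stage.
  have h2 (t : ℕ) : γ ^ t * (K / (1 - γ)) = γ ^ t * K + γ ^ (t + 1) * (K / (1 - γ)) := by
    field_simp
    ring
  have h3 (t : ℕ) : 0 ≤ γ ^ t * (K / (1 - γ)) := by positivity
  induction n generalizing t with
  | zero =>
    refine (h t).le_const (CostSpace.succ (CostSpace.smul (hc t) _)) (.of_forall fun ω => ?_)
    linarith [h1 ω t, h2 t, h3 (t + 1)]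
  | succ n ih =>
    refine (h t).le_const (CostSpace.add (CostSpace.succ (CostSpace.smul (hc t) _))
        (nestedRisk_mem h hc n (t + 1))) ?_
    filter_upwards [ih (t + 1)] with ω h4
    rw [h2, Pi.add_apply]
    exact add_le_add (h1 ω t) h4

lemma nestedRisk_add_smul_le (h : ∀ t, IsCoherent ℱ P p t (ρ t)) {d : ℕ → Ω → ℝ}
    (hc : ∀ t, c t ∈ CostSpace ℱ P p t) (hd : ∀ t, d t ∈ CostSpace ℱ P p t) {l : ℝ} (hl : 0 ≤ l)
    (n t : ℕ) :
    nestedRisk ρ γ (c + l • d) n t ≤ᵐ[P] nestedRisk ρ γ c n t + l • nestedRisk ρ γ d n t := by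
  have hcd (t : ℕ) : (c + l • d) t ∈ CostSpace ℱ P p t :=
    CostSpace.add (hc t) (CostSpace.smul (hd t) l)
  induction n generalizing t with
  | zero =>
    filter_upwards [nestedRisk_zero (γ := γ) h hcd t, nestedRisk_zero (γ := γ) h hc t,
      nestedRisk_zero (γ := γ) h hd t] with ω h1 h2 h3
    simp only [Pi.add_apply, Pi.smul_apply, smul_eq_mul] at h1 h2 h3 ⊢
    rw [h1, h2, h3]
    exact le_of_eq (by ring)
  | succ n ih =>
    have mc := nestedRisk_mem (γ := γ) h hc n (t + 1)
    have md := nestedRisk_mem (γ := γ) h hd n (t + 1)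
    filter_upwards [nestedRisk_succ (γ := γ) h hcd n t, nestedRisk_succ (γ := γ) h hc n t,
      nestedRisk_succ (γ := γ) h hd n t,
      (h t).monotone _ (nestedRisk_mem h hcd n (t + 1)) _ (CostSpace.add mc (CostSpace.smul md l))
        (ih (t + 1)),
      (h t).map_add_le mc (CostSpace.smul md l),
      (h t).pos_homogeneous _ md l hl] with ω h1 h2 h3 h4 h5 h6
    simp only [Pi.add_apply, Pi.smul_apply, smul_eq_mul] at h1 h2 h3 h4 h5 h6 ⊢
    rw [h1, h2, h3]
    linarith

lemma nestedRisk_add_sum_smul_le (h : ∀ t, IsCoherent ℱ P p t (ρ t)) {ι : Type*}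
    {d : ι → ℕ → Ω → ℝ} (hc : ∀ t, c t ∈ CostSpace ℱ P p t)
    (hd : ∀ i t, d i t ∈ CostSpace ℱ P p t) {l : ι → ℝ} (hl : ∀ i, 0 ≤ l i) (s : Finset ι)
    (n t : ℕ) :
    nestedRisk ρ γ (c + ∑ i ∈ s, l i • d i) n t ≤ᵐ[P]
      nestedRisk ρ γ c n t + ∑ i ∈ s, l i • nestedRisk ρ γ (d i) n t := by
  classical
  induction s using Finset.induction_on generalizing c with
  | empty => simpa using EventuallyLE.refl _ _
  | insert i s hi ih =>
    have hcd (t : ℕ) : (c + l i • d i) t ∈ CostSpace ℱ P p t :=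
      CostSpace.add (hc t) (CostSpace.smul (hd i t) _)
    -- The term for `i` is absorbed into the base cost, which is why the induction generalizes `c`.
    rw [Finset.sum_insert hi, Finset.sum_insert hi, ← add_assoc, ← add_assoc]
    filter_upwards [ih hcd, nestedRisk_add_smul_le (γ := γ) h hc (hd i) (hl i) n t] with ω h1 h2
    exact h1.trans (add_le_add_left h2 _)

/-- Bellman inequality for the nested risk: a process `W` with `W_t ≤ c_t + γ ρ_t(W_{t+1})` is a
lower bound up to a geometrically small error. -/
lemma sub_le_nestedRisk [IsFiniteMeasure P] (h : ∀ t, IsCoherent ℱ P p t (ρ t))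
    (hc : ∀ t, c t ∈ CostSpace ℱ P p t) (hγ : 0 ≤ γ) {W R : ℕ → Ω → ℝ}
    (hW : ∀ t, W t ∈ CostSpace ℱ P p t) (hR : ∀ t, ρ t (W (t + 1)) =ᵐ[P] R t)
    (hWR : ∀ t ω, W t ω ≤ c t ω + γ * R t ω) {K : ℝ} (hK : ∀ t ω, R t ω ≤ K) (n t : ℕ) :
    ∀ᵐ ω ∂P, γ ^ t * W t ω - γ ^ (t + n + 1) * K ≤ nestedRisk ρ γ c n t ω := by
  induction n generalizing t with
  | zero =>
    filter_upwards [nestedRisk_zero (γ := γ) h hc t] with ω h1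
    rw [h1]
    simp only [Pi.smul_apply, smul_eq_mul]
    have h2 := mul_le_mul_of_nonneg_left (hWR t ω) (pow_nonneg hγ t)
    have h3 := mul_le_mul_of_nonneg_left (hK t ω) (pow_nonneg hγ (t + 1))
    rw [add_zero]
    rw [pow_succ] at h3 ⊢
    linarith
  | succ n ih =>
    -- The error depends only on `t + n` and is a constant, so translation invariance passes it
    -- unchanged through `ρ t`.
    have hk : (fun _ : Ω => -(γ ^ (t + (n + 1) + 1) * K)) ∈ CostSpace ℱ P p t :=
      CostSpace.const _
    have hw := CostSpace.smul (hW (t + 1)) (γ ^ (t + 1))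
    filter_upwards [nestedRisk_succ (γ := γ) h hc n t, hR t,
      (h t).translation _ hk _ hw,
      (h t).pos_homogeneous _ (hW (t + 1)) _ (pow_nonneg hγ (t + 1)),
      (h t).monotone _ (CostSpace.add (CostSpace.succ hk) hw) _
        (nestedRisk_mem (γ := γ) h hc n (t + 1)) (by
        filter_upwards [ih (t + 1)] with ω h1
        simp only [Pi.add_apply, Pi.smul_apply, smul_eq_mul]
        rw [show t + (n + 1) + 1 = t + 1 + n + 1 by ring]
        linarith)] with ω h1 h2 h3 h4 h5
    simp only [Pi.add_apply, Pi.smul_apply, smul_eq_mul] at h1 h2 h3 h4 h5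
    rw [h3, h4, h2] at h5
    have h6 := mul_le_mul_of_nonneg_left (hWR t ω) (pow_nonneg hγ t)
    rw [h1]
    rw [pow_succ γ t] at h5
    linarith

/-- `limUnder` is meaningful only where a limit exists; here the nested risks are almost surely
increasing and bounded. -/
lemma tendsto_nestedRisk [IsFiniteMeasure P] (h : ∀ t, IsCoherent ℱ P p t (ρ t))
    (hc : ∀ t, c t ∈ CostSpace ℱ P p t) (hγ : 0 ≤ γ) (hγ₁ : γ < 1) {K : ℝ} (hK : 0 ≤ K)
    (hc0 : ∀ t ω, 0 ≤ c t ω) (hcK : ∀ t ω, c t ω ≤ K) :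
    ∀ᵐ ω ∂P, Tendsto (fun n => nestedRisk ρ γ c n 0 ω) atTop (nhds (totalRisk ρ γ c ω)) := by
  filter_upwards [ae_all_iff.2 fun n => nestedRisk_le_succ h hc hγ hc0 n 0,
    ae_all_iff.2 fun n => nestedRisk_le h hc hγ hγ₁ hK hcK n 0] with ω h1 h2
  exact tendsto_nhds_limUnder ⟨_, tendsto_atTop_ciSup (monotone_nat_of_le_succ h1)
    ⟨_, Set.forall_mem_range.2 h2⟩⟩

lemma integrable_totalRisk [IsFiniteMeasure P] (h : ∀ t, IsCoherent ℱ P p t (ρ t))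
    (hc : ∀ t, c t ∈ CostSpace ℱ P p t) (hγ : 0 ≤ γ) (hγ₁ : γ < 1) {K : ℝ} (hK : 0 ≤ K)
    (hc0 : ∀ t ω, 0 ≤ c t ω) (hcK : ∀ t ω, c t ω ≤ K) : Integrable (totalRisk ρ γ c) P := by
  have hlim := tendsto_nestedRisk h hc hγ hγ₁ hK hc0 hcK
  refine .of_bound (C := K / (1 - γ)) (aestronglyMeasurable_of_tendsto_ae atTop
    (fun n => (nestedRisk_mem h hc n 0).2.aestronglyMeasurable) hlim) ?_
  filter_upwards [hlim, ae_all_iff.2 fun n => nestedRisk_nonneg h hc hγ hc0 n 0,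
    ae_all_iff.2 fun n => nestedRisk_le h hc hγ hγ₁ hK hcK n 0] with ω h1 h2 h3
  rw [Real.norm_of_nonneg (ge_of_tendsto' h1 h2)]
  simpa using le_of_tendsto' h1 h3

end Nested

/-! ### The controlled chain: initial marginal and stage costs -/

section Path

lemma trajMeasure_map_zero {X : ℕ → Type*} [∀ n, MeasurableSpace (X n)] (μ₀ : Measure (X 0))
    (κ : (n : ℕ) → Kernel ((i : Finset.Iic n) → X i) (X (n + 1))) [∀ n, IsMarkovKernel (κ n)] :
    (Kernel.trajMeasure μ₀ κ).map (fun ω => ω 0) = μ₀ := by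
  have h : (fun ω : (n : ℕ) → X n => ω 0) =
      (fun x : (i : Finset.Iic 0) → X i => x ⟨0, by simp⟩) ∘ Preorder.frestrictLe 0 := rfl
  rw [h, ← Measure.map_map (by fun_prop) (by fun_prop), Kernel.trajMeasure,
    Measure.map_comp _ _ (by fun_prop), Kernel.traj_map_frestrictLe, Kernel.partialTraj_self,
    Measure.id_comp]
  -- `Iic 0` has a single index, so evaluation there undoes the equivalence along which `μ₀` is
  -- transported.
  let e := MeasurableEquiv.piUnique fun i : Finset.Iic 0 => X i
  have he : Measurable fun x : (i : Finset.Iic 0) → X i => x ⟨0, by simp⟩ := measurable_pi_apply _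
  have hm := Measure.map_map (μ := μ₀) he e.symm.measurable
  exact hm.trans Measure.map_id

variable {S A : Type*}

lemma initialLaw_map_fst (M : MDP S A) (π : Policy S A) :
    (initialLaw M π).map Prod.fst = M.κ₀ := by
  simp only [initialLaw, PMF.map_bind, PMF.map_comp]
  have h (s : S) : Prod.fst ∘ Prod.mk (β := A) s = Function.const A s := rfl
  simp only [h, PMF.map_const, PMF.bind_pure]

variable [MeasurableSpace S] [MeasurableSpace A]
  [DiscreteMeasurableSpace S] [DiscreteMeasurableSpace A]

lemma integral_state_zero [Fintype S] [Finite A] (M : MDP S A) (π : Policy S A) (V : S → ℝ) :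
    ∫ ω, V (state 0 ω) ∂(pathMeasure M π) = ∑ s, (M.κ₀ s).toReal * V s := by
  have h : (pathMeasure M π).map (state 0) = M.κ₀.toMeasure := by
    have h1 : state (S := S) (A := A) 0 = Prod.fst ∘ fun ω => ω 0 := rfl
    rw [h1, ← Measure.map_map measurable_fst (by fun_prop), pathMeasure,
      trajMeasure_map_zero (X := fun _ => S × A), PMF.toMeasure_map (hf := measurable_fst),
      initialLaw_map_fst]
  have hs : Measurable (state (S := S) (A := A) 0) := measurable_fst.comp (measurable_pi_apply 0)
  rw [← integral_map (f := V) hs.aemeasurable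
    (Measurable.of_discrete (f := V)).aestronglyMeasurable, h, PMF.integral_eq_sum]
  simp only [smul_eq_mul]

lemma comp_mem_costSpace [Finite S] [Finite A] (P : Measure (Trajectory S A)) [IsFiniteMeasure P]
    (p : ENNReal) (t : ℕ) (g : S → A → ℝ) :
    (fun ω => g (state t ω) (action t ω)) ∈ CostSpace history P p t := by
  have h1 : Measurable[history (S := S) (A := A) t] fun ω : Trajectory S A => ω t := by
    have h2 : Measurable fun x : (i : Set.Iic t) → S × A => x ⟨t, Set.self_mem_Iic⟩ :=
      measurable_pi_apply (⟨t, Set.self_mem_Iic⟩ : Set.Iic t)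
    exact h2.comp (comap_measurable _)
  have h3 : Measurable[history (S := S) (A := A) t]
      fun ω : Trajectory S A => g (state t ω) (action t ω) :=
    (Measurable.of_discrete (f := fun x : S × A => g x.1 x.2)).comp h1
  obtain ⟨K, hK⟩ := (Set.finite_range fun x : S × A => ‖g x.1 x.2‖).bddAbove
  exact ⟨h3, .of_bound (h3.mono (history.le t) le_rfl).aestronglyMeasurable K
    (.of_forall fun ω => hK ⟨ω t, rfl⟩)⟩

end Path

/-- Weak duality for a single policy. -/
lemma bellmanObjective_add_le {S A : Type*} [Fintype S] [Finite A]
    [MeasurableSpace S] [MeasurableSpace A]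
    [DiscreteMeasurableSpace S] [DiscreteMeasurableSpace A]
    {M : MDP S A} {γ : ℝ} (hγ₀ : 0 ≤ γ) (hγ₁ : γ < 1) {p : ENNReal}
    {c : S → A → ℝ} (hc : ∀ s a, 0 ≤ c s a)
    {n : ℕ} {d : Fin n → S → A → ℝ} (hd : ∀ i s a, 0 ≤ d i s a) {π : Policy S A}
    {ρ : ℕ → (Trajectory S A → ℝ) → (Trajectory S A → ℝ)} {σ : RiskTransitionMapping S}
    (hcoh : ∀ t, IsCoherent history (pathMeasure M π) p t (ρ t))
    (hmarkov : ∀ t, IsMarkovRisk M π σ t (ρ t))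
    {V : S → ℝ} {lam : Fin n → ℝ} (hfeas : (V, lam) ∈ bellmanFeasible M σ γ c d) :
    ∑ s, (M.κ₀ s).toReal * V s ≤
      dynamicRisk M π ρ γ c + ∑ i, lam i * dynamicRisk M π ρ γ (d i) := by
  set P := pathMeasure M π
  let C (g : S → A → ℝ) (t : ℕ) (ω : Trajectory S A) : ℝ := g (state t ω) (action t ω)
  have mem (g : S → A → ℝ) (t : ℕ) : C g t ∈ CostSpace history P p t :=
    comp_mem_costSpace P p t g
  have bound (g : S → A → ℝ) : ∃ K, 0 ≤ K ∧ ∀ t ω, C g t ω ≤ K := by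
    obtain ⟨K, hK⟩ := (Set.finite_range fun x : S × A => g x.1 x.2).bddAbove
    exact ⟨max K 0, le_max_right _ _, fun t ω => (hK ⟨ω t, rfl⟩).trans (le_max_left _ _)⟩
  have lim (g : S → A → ℝ) (hg : ∀ s a, 0 ≤ g s a) :
      ∀ᵐ ω ∂P, Tendsto (fun k => nestedRisk ρ γ (C g) k 0 ω) atTop
        (nhds (totalRisk ρ γ (C g) ω)) := by
    obtain ⟨K, hK, hgK⟩ := bound g
    exact tendsto_nestedRisk hcoh (mem g) hγ₀ hγ₁ hK (fun _ _ => hg _ _) hgK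
  have int (g : S → A → ℝ) (hg : ∀ s a, 0 ≤ g s a) : Integrable (totalRisk ρ γ (C g)) P := by
    obtain ⟨K, hK, hgK⟩ := bound g
    exact integrable_totalRisk hcoh (mem g) hγ₀ hγ₁ hK (fun _ _ => hg _ _) hgK
  obtain ⟨K, -, hK⟩ := bound fun s a => σ V s (M.T s a)
  have memL (t : ℕ) : (C c + ∑ i, lam i • C (d i)) t ∈ CostSpace history P p t := by
    convert mem (fun s a => c s a + ∑ i, lam i * d i s a) t using 1
    ext ω
    simp [C]
  -- The Markov property identifies `ρ_t(V(s_{t+1}))` with the `σ` term, bounded above by `K`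
  -- because there are finitely many state-action pairs.
  have lower (k : ℕ) := sub_le_nestedRisk hcoh memL hγ₀ (mem fun s _ => V s)
    (R := C fun s a => σ V s (M.T s a)) (fun t => hmarkov t V)
    (fun t ω => by simpa [C] using hfeas.2 (state t ω) (action t ω)) hK k 0
  have key : ∀ᵐ ω ∂P, V (state 0 ω) ≤
      totalRisk ρ γ (C c) ω + ∑ i, lam i * totalRisk ρ γ (C (d i)) ω := by
    filter_upwards [ae_all_iff.2 lower, lim c hc, ae_all_iff.2 fun i => lim (d i) (hd i),
      ae_all_iff.2 fun k => nestedRisk_add_sum_smul_le (γ := γ) hcoh (mem c)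
        (fun i => mem (d i)) hfeas.1 Finset.univ k 0] with ω h1 h2 h3 h4
    have hl : Tendsto (fun k => V (state 0 ω) - γ ^ (k + 1) * K) atTop
        (nhds (V (state 0 ω) - 0 * K)) :=
      tendsto_const_nhds.sub
        (((tendsto_add_atTop_iff_nat 1).2
          (tendsto_pow_atTop_nhds_zero_of_lt_one hγ₀ hγ₁)).mul_const K)
    have hr := h2.add (tendsto_finsetSum Finset.univ fun i _ => (h3 i).const_mul (lam i))
    rw [zero_mul, sub_zero] at hl
    refine le_of_tendsto_of_tendsto' hl hr fun k => ?_
    have h5 := (h1 k).trans (h4 k)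
    simpa [C] using h5
  have hVint : Integrable (fun ω => V (state 0 ω)) P :=
    have hs : Measurable (state (S := S) (A := A) 0) :=
      measurable_fst.comp (measurable_pi_apply 0)
    have hV : Measurable fun ω : Trajectory S A => V (state 0 ω) := Measurable.of_discrete.comp hs
    (MemLp.of_bound hV.aestronglyMeasurable _ (.of_forall fun ω =>
      (Set.finite_range fun s => ‖V s‖).bddAbove.choose_spec ⟨state 0 ω, rfl⟩)).integrable le_rfl
  have hsum (i : Fin n) : Integrable (fun ω => lam i * totalRisk ρ γ (C (d i)) ω) P :=
    (int (d i) (hd i)).const_mul _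
  calc ∑ s, (M.κ₀ s).toReal * V s = ∫ ω, V (state 0 ω) ∂P := (integral_state_zero M π V).symm
    _ ≤ ∫ ω, (totalRisk ρ γ (C c) ω + ∑ i, lam i * totalRisk ρ γ (C (d i)) ω) ∂P :=
      integral_mono_ae hVint ((int c hc).add (integrable_finsetSum _ fun i _ => hsum i)) key
    _ = _ := by
      rw [integral_add (int c hc) (integrable_finsetSum _ fun i _ => hsum i),
        integral_finsetSum _ fun i _ => hsum i]
      simp only [integral_const_mul]
      rfl

end RiskMDP

/-- Every solution `(V, lam)` of the Bellman optimization problem gives a lower bound of the value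
of the constrained risk-averse Markov decision problem. -/
theorem theorem1 {S A : Type*} [Fintype S] [Fintype A]
    [MeasurableSpace S] [MeasurableSpace A]
    [DiscreteMeasurableSpace S] [DiscreteMeasurableSpace A]
    (M : RiskMDP.MDP S A) (γ : ℝ) (hγ₀ : 0 < γ) (hγ₁ : γ < 1)
    (p : ENNReal) (hp₁ : 1 ≤ p) (hp₂ : p ≠ ⊤)
    (c : S → A → ℝ) (hc : ∀ s a, 0 ≤ c s a)
    (n : ℕ) (d : Fin n → S → A → ℝ) (hd : ∀ i s a, 0 ≤ d i s a)
    (β : Fin n → ℝ) (hβ : ∀ i, 0 < β i)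
    (adm : Set (RiskMDP.Policy S A))
    (ρ : RiskMDP.Policy S A → ℕ →
      (RiskMDP.Trajectory S A → ℝ) → (RiskMDP.Trajectory S A → ℝ))
    (σ : RiskMDP.RiskTransitionMapping S)
    (hcoh : ∀ π ∈ adm, ∀ t,
      RiskMDP.IsCoherent RiskMDP.history (RiskMDP.pathMeasure M π) p t (ρ π t))
    (hmarkov : ∀ π ∈ adm, ∀ t, RiskMDP.IsMarkovRisk M π σ t (ρ π t))
    (V : S → ℝ) (lam : Fin n → ℝ)
    (hfeas : (V, lam) ∈ RiskMDP.bellmanFeasible M σ γ c d)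
    (hmax : IsMaxOn (RiskMDP.bellmanObjective M β) (RiskMDP.bellmanFeasible M σ γ c d) (V, lam)) :
    ((∑ s, (M.κ₀ s).toReal * V s - ∑ i, lam i * β i : ℝ) : EReal) ≤
      RiskMDP.constrainedValue M adm ρ γ c d β := by
  refine le_iInf₂ fun π hπ => EReal.coe_le_coe_iff.2 ?_
  have h1 := RiskMDP.bellmanObjective_add_le hγ₀.le hγ₁ hc hd (hcoh π hπ.1) (hmarkov π hπ.1) hfeas
  -- The sign of `lam` turns the constraints into a bound on the penalty.
  have h2 : ∑ i, lam i * RiskMDP.dynamicRisk M π (ρ π) γ (d i) ≤ ∑ i, lam i * β i :=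
    Finset.sum_le_sum fun i _ => mul_le_mul_of_nonneg_left (hπ.2 i) (hfeas.1 i)
  linarith
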